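/- Let $k\ge 2$ be an even integer and let $\mathcal{Y}$ be a discrete set. A channel $W\colon[k]\to\mathcal{Y}$ is given by probabilities $W(y\mid x)\ge 0$ with $\sum_{y\in\mathcal Y} W(y\mid x)=1$ for each $x\in[k]$. For a distribution $\mathbf{p}$ on $[k]$ put $\mathbf{p}^W(y)=\sum_x W(y\mid x)\mathbf{p}(x)$. Let $\mathbf{u}$ be the uniform distribution on $[k]$. An almost $\varepsilon$-perturbation $\mathcal{P}_\zeta=(\mathcal{P},\zeta)$ around $\mathbf{u}$ is a family $\mathcal{P}=\{\mathbf{p}_z\}_{z\in\mathcal{Z}}$ of distributions on $[k]$ with a probability distribution $\zeta$ on $\mathcal{Z}$ such that $\Pr_{Z\sim\zeta}[d_{\mathrm{TV}}(\mathbf{p}_Z,\mathbf{u})\ge\varepsilon]\ge 1/10$. Let $\Upsilon_\varepsilon$ be the set of all of them. With $\delta_z^W(y)=(\mathbf{p}_z^W(y)-\mathbf{u}^W(y))/\mathbf{u}^W(y)$ and $\langle\delta_z^W,\delta_{z'}^W\rangle=\mathbb{E}_{Y\sim\mathbf{u}^W}[\delta_z^W(Y)\delta_{z'}^W(Y)]$,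 the decoupled chi-square fluctuation of $W^n=(W_1,\dots,W_n)$ is $$\chi^{(2)}(W^n\mid\mathcal{P}_\zeta)=\ln\mathbb{E}_{Z,Z'}\exp\Big(\sum_{i=1}^n\langle\delta_Z^{W_i},\delta_{Z'}^{W_i}\rangle\Big),\qquad Z,Z'\ \text{i.i.d. with law}\ \zeta.$$ For a nonempty family $\mathcal{W}$ of channels $[k]\to\mathcal{Y}$ with convex hull $\overline{\mathcal{W}}$ and $s\in\mathbb{N}$, the $(n,\varepsilon,s)$-semimaxmin decoupled chi-square fluctuation of $\mathcal W$ is $$\underline{\overline{\chi}}^{(2)}(\mathcal{W}^n,\varepsilon,s)=\sup_{\mathcal{W}_s}\ \inf_{\mathcal{P}_\zeta\in\Upsilon_\varepsilon}\ \mathbb{E}\big[\min\{\chi^{(2)}(W^n\mid\mathcal{P}_\zeta),1\}\big],$$ where the supremum is over nonempty multisets $\mathcal{W}_s$ of elements of $\overline{\mathcal{W}}^n$ of size at most $2^s$, and $W^n$ is uniform on $\mathcal{W}_s$. Finally, let $H(W)$ be the $(k/2)\times(k/2)$ matrix with entries $$H(W)_{i,j}=\sum_{y\in\mathcal{Y}}\frac{(W(y\mid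 2i-1)-W(y\mid 2i))(W(y\mid 2j-1)-W(y\mid 2j))}{\sum_{x\in[k]}W(y\mid x)}$$ (terms with zero denominator being $0$), let $\|\cdot\|_*$ be the nuclear norm, and let $M=\sup_{W\in\mathcal{W}}\|H(W)\|_*$. **Theorem.** There are absolute constants $C,K>0$ such that for all even $k\ge2$, all $n,s\in\mathbb{N}$, all $\varepsilon\in(0,\tfrac{1}{12\sqrt2})$, and every nonempty family $\mathcal{W}$ of channels from $[k]$ to a discrete set $\mathcal{Y}$, if $$n\le\frac{k^{3/2}}{C\,\varepsilon^2\,2^{s/2}\,M}$$ (which is no restriction when $M=0$), then $$\underline{\overline{\chi}}^{(2)}(\mathcal{W}^n,\varepsilon,s)\le K\cdot\frac{n^2\varepsilon^4}{k^3}\cdot2^s\cdot M^2 .$$ -/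

import Mathlib

open MeasureTheory
open scoped ENNReal

noncomputable section

namespace Semimaxmin

/-- `W x y` is the probability that the channel `W : [k] → Y` outputs the symbol `y` of the
discrete alphabet `Y` on input `x`. -/
def IsChannel {k : ℕ} {Y : Type*} (W : Fin k → Y → ℝ) : Prop :=
  (∀ x y, 0 ≤ W x y) ∧ ∀ x, HasSum (W x) 1

/-- The uniform distribution on `[k]`. -/
def unif (k : ℕ) : Fin k → ℝ := fun _ => 1 / (k : ℝ)

/-- Total variation distance between two probability mass functions on `[k]`. -/
def tvDist {k : ℕ} (p q : Fin k → ℝ) : ℝ := (1 / 2) * ∑ x, |p x - q x|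

/-- The output distribution `p^W` induced by the input distribution `p` and the channel `W`. -/
def induced {k : ℕ} {Y : Type*} (W : Fin k → Y → ℝ) (p : Fin k → ℝ) (y : Y) : ℝ :=
  ∑ x, W x y * p x

/-- The normalized difference `δ^W = (p^W - q^W) / q^W`. Where `q^W` vanishes it is `0`; such `y`
have weight zero in every expectation under `q^W`. -/
def delta {k : ℕ} {Y : Type*} (q : Fin k → ℝ) (W : Fin k → Y → ℝ) (p : Fin k → ℝ) (y : Y) : ℝ :=
  (induced W p y - induced W q y) / induced W q y

/-- The inner product `⟨δ_p^W, δ_{p'}^W⟩`, an expectation under the output distribution `q^W` of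
the reference distribution `q`. -/
def deltaInner {k : ℕ} {Y : Type*} (q : Fin k → ℝ) (W : Fin k → Y → ℝ) (p p' : Fin k → ℝ) : ℝ :=
  ∑' y, induced W q y * (delta q W p y * delta q W p' y)

/-- An almost `ε`-perturbation `(𝒫, ζ)` around `q`: a family of distributions `p_z` on `[k]`
indexed by `z ∈ Z` and a probability distribution `ζ` on `Z` such that `p_z` is at total variation
distance at least `ε` from `q` with `ζ`-probability at least `1/10`. -/
structure AlmostPerturbation {k : ℕ} (q : Fin k → ℝ) (ε : ℝ) where
  Z : Type
  [mZ : MeasurableSpace Z]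
  p : Z → Fin k → ℝ
  measurable_p : Measurable p
  p_mem : ∀ z, p z ∈ stdSimplex ℝ (Fin k)
  ζ : Measure Z
  [prob : IsProbabilityMeasure ζ]
  far : (1 / 10 : ℝ) ≤ ζ.real {z | ε ≤ tvDist (p z) q}

attribute [instance] AlmostPerturbation.mZ AlmostPerturbation.prob

/-- The decoupled chi-square fluctuation
`χ²(Wⁿ | 𝒫_ζ) = ln E_{Z,Z'} exp (∑ᵢ ⟨δ_Z^{Wᵢ}, δ_{Z'}^{Wᵢ}⟩)`, with `Z, Z'` independent of
law `ζ`. -/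
def chiSq {k n : ℕ} {Y : Type*} {q : Fin k → ℝ} {ε : ℝ} (Wn : Fin n → Fin k → Y → ℝ)
    (P : AlmostPerturbation q ε) : ℝ :=
  Real.log (∫ z, Real.exp (∑ i, deltaInner q (Wn i) (P.p z.1) (P.p z.2)) ∂(P.ζ.prod P.ζ))

/-- The `(n, ε, s)`-semimaxmin decoupled chi-square fluctuation around `q` of the family `𝒲`: the
supremum over nonempty multisets `S` of at most `2^s` tuples of channels from the convex hull of
`𝒲`, the infimum over almost `ε`-perturbations around `q`, and the average over `S` of
`χ² ∧ 1`. It is an extended real, so that an infimum over no perturbation is `⊤`. -/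
def semimaxmin {k : ℕ} {Y : Type*} (q : Fin k → ℝ) (𝒲 : Set (Fin k → Y → ℝ)) (n : ℕ) (ε : ℝ)
    (s : ℕ) : EReal :=
  ⨆ (S : Multiset (Fin n → Fin k → Y → ℝ)) (_ : S ≠ 0) (_ : S.card ≤ 2 ^ s)
    (_ : ∀ Wn ∈ S, ∀ i, Wn i ∈ convexHull ℝ 𝒲),
  ⨅ P : AlmostPerturbation q ε,
    (((S.map fun Wn => min (chiSq Wn P) 1).sum / (S.card : ℝ) : ℝ) : EReal)

/-- The input symbol `2i - 1` of `[k] = {1, …, k}`, counted here from `0`. -/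
def oddSym {k : ℕ} (i : Fin (k / 2)) : Fin k := ⟨2 * i.1, by omega⟩

/-- The input symbol `2i` of `[k] = {1, …, k}`, counted here from `0`. -/
def evenSym {k : ℕ} (i : Fin (k / 2)) : Fin k := ⟨2 * i.1 + 1, by omega⟩

/-- The matrix `H(W)`. Symbols `y` of probability zero under every input contribute `0`. -/
def H {k : ℕ} {Y : Type*} (W : Fin k → Y → ℝ) : Matrix (Fin (k / 2)) (Fin (k / 2)) ℝ :=
  fun i j => ∑' y, (W (oddSym i) y - W (evenSym i) y) * (W (oddSym j) y - W (evenSym j) y) /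
    ∑ x, W x y

/-- The nuclear norm of a square matrix: the sum of its singular values. -/
def nuclearNorm {d : ℕ} (A : Matrix (Fin d) (Fin d) ℝ) : ℝ :=
  ∑ i : Fin d, (Matrix.toEuclideanLin A).singularValues i

/-- `max_{W ∈ 𝒲} ‖H(W)‖_*`, as a supremum (it is at most `k` for channels). -/
def maxNuclear {k : ℕ} {Y : Type*} (𝒲 : Set (Fin k → Y → ℝ)) : ℝ :=
  sSup ((fun W => nuclearNorm (H W)) '' 𝒲)

end Semimaxmin

end

noncomputable section

namespace Semimaxmin

open scoped BigOperators RealInnerProductSpace Matrix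

/-! Perturb the uniform law pairwise: the two masses of the i-th pair become (1 ± 16ε zᵢ)/k, with z
in the cube [-1,1]^d, d = k/2. The inner product of two fluctuations is then (16ε)²/k · zᵀH(W)z'. So
a tuple enters only through A = ∑ᵢ H(Wᵢ), which is positive semidefinite of trace at most τ = nM;
the trace bound passes to the convex hull because tr H is convex in W.

It remains to find one law of z that suits all of the at most R = 2^s matrices A. Their sum has
trace at most Rτ, so by Markov's inequality on eigenvalues its form is at most β = 2Rτ/d on a
subspace of dimension at least d/2 (`exists_subspace_form_le`), and each A is dominated by the sum.
A random walk in that subspace which freezes nearly saturated coordinates stays in the cube and is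
subgaussian with a dimension-free constant, yet E‖z‖² ≥ d/4 (`exists_subgaussian_in_subspace`);
hence ∑|zᵢ| is of order d with constant probability. For such a law E exp(l zᵀAz') ≤ exp(4l²βτ) once
l²βτ ≤ 1/8 (`expect_exp_decoupled_le`), and l = (16ε)²/k turns l²βτ into a constant times
n²ε⁴2^sM²/k³. -/

/-! ### Averages over random signs -/

/-- The sign `±1` encoded by a Boolean. -/
def sgn (b : Bool) : ℝ := if b then 1 else -1

lemma sgn_sq (b : Bool) : sgn b ^ 2 = 1 := by cases b <;> simp [sgn]

lemma sgn_not (b : Bool) : sgn (!b) = -sgn b := by cases b <;> simp [sgn]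

lemma expect_signs_eq_zero {d : ℕ} (c : Fin d → ℝ) :
    𝔼 y : Fin d → Bool, ∑ j, sgn (y j) * c j = 0 := by
  have h : 𝔼 y : Fin d → Bool, ∑ j, sgn (y j) * c j
      = 𝔼 y : Fin d → Bool, -∑ j, sgn (y j) * c j := by
    refine Fintype.expect_equiv (Equiv.arrowCongr (Equiv.refl _) Equiv.boolNot) _ _ fun y => ?_
    simp [Equiv.arrowCongr, sgn_not]
  rw [Finset.expect_neg_distrib] at h
  linarith

/-- Independence factors the average into ∏ cosh(cⱼ), and cosh x ≤ exp(x²/2). -/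
lemma expect_exp_signs_le {d : ℕ} (c : Fin d → ℝ) :
    𝔼 y : Fin d → Bool, Real.exp (∑ j, sgn (y j) * c j) ≤ Real.exp ((∑ j, c j ^ 2) / 2) := by
  have h1 : ∑ y : Fin d → Bool, Real.exp (∑ j, sgn (y j) * c j)
      = ∏ j, (2 * Real.cosh (c j)) := by
    have := Finset.prod_univ_sum (fun _ : Fin d => (Finset.univ : Finset Bool))
      (fun j b => Real.exp (sgn b * c j))
    rw [Fintype.piFinset_univ] at this
    simp_rw [Real.exp_sum]
    rw [← this]
    refine Finset.prod_congr rfl fun j _ => ?_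
    simp [sgn, Real.cosh_eq]
    ring
  rw [Fintype.expect_eq_sum_div_card, h1, Finset.prod_mul_distrib, Finset.sum_div, Real.exp_sum]
  simp only [Finset.prod_const, Finset.card_univ, Fintype.card_fin, Fintype.card_fun,
    Fintype.card_bool, Nat.cast_pow, Nat.cast_ofNat]
  rw [mul_div_cancel_left₀ _ (by positivity)]
  exact Finset.prod_le_prod (fun j _ => (Real.cosh_pos _).le) fun j _ => Real.cosh_le_exp_half_sq _

/-! ### A subgaussian law in the cube and in a subspace -/

/-- An orthonormal basis of a subspace, padded with zero vectors. -/
lemma exists_padded_orthonormal {d : ℕ} (U : Submodule ℝ (EuclideanSpace ℝ (Fin d))) :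
    ∃ v : Fin d → EuclideanSpace ℝ (Fin d), (∀ j, v j ∈ U) ∧
      (∀ θ, ∑ j, ⟪v j, θ⟫ ^ 2 ≤ ‖θ‖ ^ 2) ∧
      ∀ y : Fin d → ℝ, (∀ j, y j ^ 2 = 1) →
        ‖∑ j, y j • v j‖ ^ 2 = Module.finrank ℝ U := by
  set r := Module.finrank ℝ U with hr
  have hrd : r ≤ d := by simpa using U.finrank_le
  let b := stdOrthonormalBasis ℝ U
  have hinj : Function.Injective (Fin.castLE hrd) := Fin.castLE_injective hrd
  -- Padding to length d lets every step of the walk use the same sign space, although the dimension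
  -- of the allowed directions varies.
  let v : Fin d → EuclideanSpace ℝ (Fin d) :=
    Function.extend (Fin.castLE hrd) (fun j => (b j : EuclideanSpace ℝ (Fin d))) 0
  have hv : ∀ j, v (Fin.castLE hrd j) = b j := fun j => hinj.extend_apply _ _ j
  have hv0 : ∀ j, j ∉ Set.range (Fin.castLE hrd) → v j = 0 := fun j hj =>
    Function.extend_apply' _ _ _ hj
  have hb : Orthonormal ℝ fun j => (b j : EuclideanSpace ℝ (Fin d)) :=
    b.orthonormal.comp_linearIsometry U.subtypeₗᵢ
  refine ⟨v, fun j => ?_, fun θ => ?_, fun y hy => ?_⟩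
  · by_cases hj : j ∈ Set.range (Fin.castLE hrd)
    · obtain ⟨i, rfl⟩ := hj
      rw [hv]; exact (b i).2
    · rw [hv0 j hj]; exact U.zero_mem
  · rw [← Fintype.sum_of_injective _ hinj (fun j => ⟪(b j : EuclideanSpace ℝ (Fin d)), θ⟫ ^ 2)
      (fun j => ⟪v j, θ⟫ ^ 2) (fun j hj => by simp [hv0 j hj]) (fun j => by simp only [hv])]
    simpa using hb.sum_inner_products_le (s := Finset.univ) θ
  · rw [← Fintype.sum_of_injective _ hinj
      (fun j => y (Fin.castLE hrd j) • (b j : EuclideanSpace ℝ (Fin d)))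
      (fun j => y j • v j) (fun j hj => by simp [hv0 j hj]) (fun j => by simp only [hv])]
    rw [← real_inner_self_eq_norm_sq, hb.inner_sum]
    simp [← pow_two, hy, hr]

lemma norm_sq_ge_of_large_coords {d : ℕ} (z : EuclideanSpace ℝ (Fin d)) :
    (9 / 16 : ℝ) * (Finset.univ.filter fun i => 3 / 4 ≤ |z i|).card ≤ ‖z‖ ^ 2 := by
  rw [EuclideanSpace.real_norm_sq_eq]
  calc (9 / 16 : ℝ) * (Finset.univ.filter fun i => 3 / 4 ≤ |z i|).card
      = ∑ i ∈ Finset.univ.filter (fun i => 3 / 4 ≤ |z i|), (9 / 16 : ℝ) := by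
        simp [mul_comm]
    _ ≤ ∑ i ∈ Finset.univ.filter (fun i => 3 / 4 ≤ |z i|), z i ^ 2 := by
        refine Finset.sum_le_sum fun i hi => ?_
        have h := (Finset.mem_filter.1 hi).2
        rw [← sq_abs]
        nlinarith
    _ ≤ ∑ i, z i ^ 2 :=
        Finset.sum_le_sum_of_subset_of_nonneg (Finset.filter_subset _ _) fun i _ _ => sq_nonneg _

/-- One step of a random walk which stays in the cube and in the subspace `Gᗮ`. -/
lemma exists_walk_step {d : ℕ} (hd : 0 < d) (G : Submodule ℝ (EuclideanSpace ℝ (Fin d)))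
    (hG : 2 * Module.finrank ℝ G ≤ d) (h : ℝ) (hh : h ^ 2 = 1 / (16 * d))
    (z : EuclideanSpace ℝ (Fin d)) (hz : ∀ i, |z i| ≤ 1) (hzG : z ∈ Gᗮ) :
    ∃ g : (Fin d → Bool) → EuclideanSpace ℝ (Fin d),
      (∀ y i, |(z + g y) i| ≤ 1) ∧ (∀ y, z + g y ∈ Gᗮ) ∧
      (∀ θ, 𝔼 y, Real.exp ⟪θ, g y⟫ ≤ Real.exp (h ^ 2 * ‖θ‖ ^ 2 / 2)) ∧
      ‖z‖ ^ 2 + h ^ 2 * (d / 2 - 16 / 9 * ‖z‖ ^ 2) ≤ 𝔼 y, ‖z + g y‖ ^ 2 := by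
  classical
  have hd' : (0 : ℝ) < d := by exact_mod_cast hd
  set F := Finset.univ.filter fun i => 3 / 4 ≤ |z i| with hF
  set e : Fin d → EuclideanSpace ℝ (Fin d) := fun i => EuclideanSpace.single i 1
  -- Steps are taken in `Kᗮ`: they respect `G` and do not move the coordinates already of size at
  -- least 3/4.
  set K := G ⊔ Submodule.span ℝ (F.image e : Set (EuclideanSpace ℝ (Fin d))) with hK
  have hKrank : Module.finrank ℝ K ≤ Module.finrank ℝ G + F.card := by
    refine (Submodule.finrank_add_le_finrank_add_finrank _ _).trans ?_
    gcongr
    exact (finrank_span_finset_le_card _).trans Finset.card_image_le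
  have hsum : Module.finrank ℝ K + Module.finrank ℝ Kᗮ = d := by
    simpa using K.finrank_add_finrank_orthogonal
  obtain ⟨v, hvK, hvθ, hvn⟩ := exists_padded_orthonormal Kᗮ
  have hmem : ∀ y : Fin d → Bool, ∑ j, sgn (y j) • v j ∈ Kᗮ := fun y =>
    Submodule.sum_mem _ fun j _ => Submodule.smul_mem _ _ (hvK j)
  have hnorm : ∀ y : Fin d → Bool, ‖∑ j, sgn (y j) • v j‖ ^ 2 = Module.finrank ℝ Kᗮ :=
    fun y => hvn _ fun j => sgn_sq _
  have hrd : (Module.finrank ℝ Kᗮ : ℝ) ≤ d := by exact_mod_cast (by omega)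
  have hinner : ∀ θ (y : Fin d → Bool),
      ⟪θ, h • ∑ j, sgn (y j) • v j⟫ = ∑ j, sgn (y j) * (h * ⟪v j, θ⟫) := by
    intro θ y
    simp only [inner_smul_right, inner_sum, Finset.mul_sum]
    refine Finset.sum_congr rfl fun j _ => ?_
    rw [real_inner_comm]; ring
  refine ⟨fun y => h • ∑ j, sgn (y j) • v j, fun y i => ?_, fun y => ?_, fun θ => ?_, ?_⟩
  · have hgK := hmem y
    have hgn := hnorm y
    beta_reduce
    generalize ∑ j, sgn (y j) • v j = g at hgK hgn ⊢
    have hadd : (z + h • g) i = z i + h * g i := rfl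
    change |(z + h • g) i| ≤ 1
    rw [hadd]
    by_cases hi : 3 / 4 ≤ |z i|
    · have h0 : ⟪e i, g⟫ = 0 := by
        refine Submodule.inner_right_of_mem_orthogonal (K := K) ?_ hgK
        refine Submodule.mem_sup_right (Submodule.subset_span ?_)
        exact Finset.mem_coe.2 (Finset.mem_image_of_mem _ (by simp [hF, hi]))
      have h0' : g i = 0 := by simpa [e, EuclideanSpace.inner_single_left] using h0
      simpa [h0'] using hz i
    -- A free coordinate is below 3/4 and moves by at most |h|√d = 1/4, so it stays in [-1,1].
    · have h1 : (g i) ^ (2 : ℕ) ≤ (d : ℝ) := by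
        have := PiLp.norm_apply_le g i
        rw [Real.norm_eq_abs] at this
        calc (g i) ^ (2 : ℕ) = (|g i| : ℝ) ^ (2 : ℕ) := (sq_abs _).symm
          _ ≤ ‖g‖ ^ 2 := pow_le_pow_left₀ (abs_nonneg _) this 2
          _ ≤ d := by rw [hgn]; exact hrd
      have h2 : |h * g i| ≤ 1 / 4 := by
        apply abs_le_of_sq_le_sq _ (by norm_num)
        rw [mul_pow, hh, div_mul_eq_mul_div, div_le_iff₀ (by positivity)]
        linarith
      calc |z i + h * g i| ≤ |z i| + |h * g i| := abs_add_le _ _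
        _ ≤ 1 := by push Not at hi; linarith
  · refine Submodule.add_mem _ hzG (Submodule.smul_mem _ _ ?_)
    exact Submodule.orthogonal_le le_sup_left (hmem y)
  · simp_rw [hinner]
    refine (expect_exp_signs_le _).trans (Real.exp_le_exp.2 ?_)
    simp_rw [mul_pow]
    rw [← Finset.mul_sum]
    have := hvθ θ
    gcongr
  · have h1 : ∀ y : Fin d → Bool, ‖z + h • ∑ j, sgn (y j) • v j‖ ^ 2
        = ‖z‖ ^ 2 + h ^ 2 * Module.finrank ℝ Kᗮ + 2 * ∑ j, sgn (y j) * (h * ⟪v j, z⟫) := by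
      intro y
      rw [norm_add_sq_real, hinner, norm_smul, mul_pow, hnorm, Real.norm_eq_abs, sq_abs]
      ring
    simp_rw [h1]
    rw [Finset.expect_add_distrib, ← Finset.mul_expect, expect_signs_eq_zero,
      Fintype.expect_const]
    -- The cross term averages out, so the gain is h² dim `Kᗮ` ≥ h²(d/2 − |F|), and |F| ≤
    -- (16/9)‖z‖².
    have h2 := norm_sq_ge_of_large_coords z
    have h3 : (d : ℝ) ≤ Module.finrank ℝ Kᗮ + Module.finrank ℝ G + F.card := by
      exact_mod_cast (by omega)
    have h4 : 2 * (Module.finrank ℝ G : ℝ) ≤ d := by exact_mod_cast hG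
    have h5 : (d / 2 - 16 / 9 * ‖z‖ ^ 2 : ℝ) ≤ Module.finrank ℝ Kᗮ := by
      rw [← hF] at h2
      linarith
    have := mul_le_mul_of_nonneg_left h5 (sq_nonneg h)
    linarith

/-- A distribution on the cube inside a subspace of dimension at least `d / 2` which is subgaussian
with variance proxy independent of `d`, yet has second moment of order `d`. -/
lemma exists_subgaussian_walk {d : ℕ} (hd : 0 < d) (G : Submodule ℝ (EuclideanSpace ℝ (Fin d)))
    (hG : 2 * Module.finrank ℝ G ≤ d) (N : ℕ) :
    ∃ (Ω : Type) (_ : Fintype Ω) (_ : Nonempty Ω) (z : Ω → EuclideanSpace ℝ (Fin d)),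
      (∀ ω i, |z ω i| ≤ 1) ∧ (∀ ω, z ω ∈ Gᗮ) ∧
      (∀ θ, 𝔼 ω, Real.exp ⟪θ, z ω⟫ ≤ Real.exp (N / (32 * d) * ‖θ‖ ^ 2)) ∧
      9 / 32 * d * (1 - (1 - 1 / (9 * d)) ^ N) ≤ 𝔼 ω, ‖z ω‖ ^ 2 := by
  have hd' : (1 : ℝ) ≤ d := by exact_mod_cast hd
  induction N with
  | zero =>
    refine ⟨Unit, inferInstance, inferInstance, fun _ => 0, ?_, ?_, ?_, ?_⟩ <;> simp
  | succ N ih =>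
    obtain ⟨Ω, _, _, z, hz1, hzG, hsub, hsq⟩ := ih
    have hh : (√(1 / (16 * d) : ℝ)) ^ 2 = 1 / (16 * d) := Real.sq_sqrt (by positivity)
    choose g hg1 hgG hgsub hgsq using fun ω =>
      exists_walk_step hd G hG _ hh (z ω) (hz1 ω) (hzG ω)
    rw [hh] at hgsub hgsq
    refine ⟨Ω × (Fin d → Bool), inferInstance, inferInstance, fun p => z p.1 + g p.1 p.2,
      fun p i => hg1 _ _ i, fun p => hgG _ _, fun θ => ?_, ?_⟩
    · rw [← Finset.univ_product_univ, Finset.expect_product]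
      simp_rw [inner_add_right, Real.exp_add, ← Finset.mul_expect]
      calc 𝔼 ω, Real.exp ⟪θ, z ω⟫ * 𝔼 y, Real.exp ⟪θ, g ω y⟫
          ≤ 𝔼 ω, Real.exp ⟪θ, z ω⟫ * Real.exp (1 / (16 * d) * ‖θ‖ ^ 2 / 2) :=
            Finset.expect_le_expect fun ω _ => by
              have := hgsub ω θ
              gcongr
        _ = (𝔼 ω, Real.exp ⟪θ, z ω⟫) * Real.exp (1 / (16 * d) * ‖θ‖ ^ 2 / 2) :=
            (Finset.expect_mul _ _ _).symm
        _ ≤ Real.exp (N / (32 * d) * ‖θ‖ ^ 2) * Real.exp (1 / (16 * d) * ‖θ‖ ^ 2 / 2) := by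
            have := hsub θ
            gcongr
        _ = _ := by
            rw [← Real.exp_add]
            congr 1
            push_cast
            field_simp
            ring
    · rw [← Finset.univ_product_univ, Finset.expect_product]
      -- The lower bound solves a ↦ (1 − 1/(9d)) a + 1/32 started at 0, whose fixed point is 9d/32.
      calc 9 / 32 * (d : ℝ) * (1 - (1 - 1 / (9 * d)) ^ (N + 1))
          = (1 - 1 / (9 * d)) * (9 / 32 * d * (1 - (1 - 1 / (9 * d)) ^ N)) + 1 / 32 := by
            rw [pow_succ]
            field_simp
            ring
        _ ≤ (1 - 1 / (9 * d)) * 𝔼 ω, ‖z ω‖ ^ 2 + 1 / 32 := by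
            have : 0 ≤ 1 - 1 / (9 * d : ℝ) := by
              rw [sub_nonneg, div_le_one (by positivity)]
              linarith
            gcongr
        _ = 𝔼 ω, (‖z ω‖ ^ 2 + 1 / (16 * d) * (d / 2 - 16 / 9 * ‖z ω‖ ^ 2)) := by
            rw [Finset.mul_expect, ← Fintype.expect_const (ι := Ω) (1 / 32 : ℝ),
              ← Finset.expect_add_distrib]
            refine Finset.expect_congr rfl fun ω _ => ?_
            field_simp
            ring
        _ ≤ _ := Finset.expect_le_expect fun ω _ => hgsq ω

lemma exists_subgaussian_in_subspace {d : ℕ} (hd : 0 < d)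
    (G : Submodule ℝ (EuclideanSpace ℝ (Fin d))) (hG : 2 * Module.finrank ℝ G ≤ d) :
    ∃ (Ω : Type) (_ : Fintype Ω) (_ : Nonempty Ω) (z : Ω → EuclideanSpace ℝ (Fin d)),
      (∀ ω i, |z ω i| ≤ 1) ∧ (∀ ω, z ω ∈ Gᗮ) ∧
      (∀ θ, 𝔼 ω, Real.exp ⟪θ, z ω⟫ ≤ Real.exp (‖θ‖ ^ 2)) ∧
      (d / 4 : ℝ) ≤ 𝔼 ω, ‖z ω‖ ^ 2 := by
  -- With 27d steps the subgaussian constant is 27/32 ≤ 1, while the deficit is at most e⁻³ ≤ 1/9,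
  -- leaving 9/32 · 8/9 = 1/4.
  obtain ⟨Ω, i1, i2, z, h1, h2, h3, h4⟩ := exists_subgaussian_walk hd G hG (27 * d)
  have hd' : (1 : ℝ) ≤ d := by exact_mod_cast hd
  refine ⟨Ω, i1, i2, z, h1, h2, fun θ => (h3 θ).trans (Real.exp_le_exp.2 ?_), le_trans ?_ h4⟩
  · have : ((27 * d : ℕ) : ℝ) / (32 * d) ≤ 1 := by
      push_cast
      rw [div_le_one (by positivity)]
      linarith
    nlinarith [sq_nonneg ‖θ‖]
  · have h5 : (1 - 1 / (9 * d : ℝ)) ^ (27 * d) ≤ 1 / 9 := by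
      have h6 : 0 ≤ 1 - 1 / (9 * d : ℝ) := by
        rw [sub_nonneg, div_le_one (by positivity)]
        linarith
      have h7 : 1 - 1 / (9 * d : ℝ) ≤ Real.exp (-(1 / (9 * d))) := Real.one_sub_le_exp_neg _
      calc (1 - 1 / (9 * d : ℝ)) ^ (27 * d) ≤ Real.exp (-(1 / (9 * d))) ^ (27 * d) := by gcongr
        _ = (Real.exp 1 ^ 3)⁻¹ := by
          rw [← Real.exp_nat_mul, ← Real.exp_nat_mul, ← Real.exp_neg]
          congr 1
          push_cast
          field_simp
          norm_num
        _ ≤ 1 / 9 := by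
          rw [inv_eq_one_div]
          apply one_div_le_one_div_of_le (by norm_num)
          have := Real.exp_one_gt_d9
          calc (9 : ℝ) ≤ 2.7 ^ 3 := by norm_num
            _ ≤ _ := by gcongr; linarith
    nlinarith

/-! ### Exponential moments of squares -/

/-- Gaussian linearization: it writes exp(a²) as an average of exponentials linear in a, to which a
subgaussian bound applies. -/
lemma integral_exp_neg_sq_add_mul (a : ℝ) :
    ∫ g : ℝ, Real.exp (-g ^ 2 + 2 * a * g) = √Real.pi * Real.exp (a ^ 2) := by
  have h1 : ∀ g : ℝ, Real.exp (-g ^ 2 + 2 * a * g)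
      = Real.exp (-1 * (g - a) ^ 2) * Real.exp (a ^ 2) := fun g => by
    rw [← Real.exp_add]; congr 1; ring
  simp_rw [h1]
  rw [integral_mul_const, integral_sub_right_eq_self (fun g : ℝ => Real.exp (-1 * g ^ 2)),
    integral_gaussian, div_one]

lemma integrable_exp_neg_sq_add_mul (a : ℝ) :
    Integrable fun g : ℝ => Real.exp (-g ^ 2 + 2 * a * g) := by
  have h1 : ∀ g : ℝ, Real.exp (-g ^ 2 + 2 * a * g)
      = Real.exp (-1 * (g - a) ^ 2) * Real.exp (a ^ 2) := fun g => by
    rw [← Real.exp_add]; congr 1; ring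
  simp_rw [h1]
  exact ((integrable_exp_neg_mul_sq one_pos).comp_sub_right a).mul_const _

/-- Squares of subgaussian variables have exponential moments. -/
lemma expect_exp_sq_le {Ω : Type*} [Fintype Ω] (X : Ω → ℝ)
    (hX : ∀ t : ℝ, 𝔼 ω, Real.exp (t * X ω) ≤ Real.exp (t ^ 2)) {s : ℝ} (hs0 : 0 ≤ s)
    (hs : s ≤ 1 / 8) : 𝔼 ω, Real.exp (s * X ω ^ 2) ≤ Real.exp (4 * s) := by
  have hpi : 0 < √Real.pi := Real.sqrt_pos.2 Real.pi_pos
  have h1 : √Real.pi * 𝔼 ω, Real.exp (s * X ω ^ 2)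
      = ∫ g : ℝ, 𝔼 ω, Real.exp (-g ^ 2 + 2 * (√s * X ω) * g) := by
    simp_rw [Fintype.expect_eq_sum_div_card]
    rw [integral_div, integral_finsetSum _ fun ω _ => integrable_exp_neg_sq_add_mul _]
    simp_rw [integral_exp_neg_sq_add_mul, mul_pow, Real.sq_sqrt hs0]
    rw [← Finset.mul_sum, mul_div_assoc]
  have h2 : ∫ g : ℝ, 𝔼 ω, Real.exp (-g ^ 2 + 2 * (√s * X ω) * g)
      ≤ ∫ g : ℝ, Real.exp (-(1 - 4 * s) * g ^ 2) := by
    refine integral_mono ?_ (integrable_exp_neg_mul_sq (by linarith)) fun g => ?_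
    · simp_rw [Fintype.expect_eq_sum_div_card]
      exact (integrable_finsetSum _ fun ω _ => integrable_exp_neg_sq_add_mul _).div_const _
    · have h3 : ∀ ω, Real.exp (-g ^ 2 + 2 * (√s * X ω) * g)
          = Real.exp (-g ^ 2) * Real.exp ((2 * √s * g) * X ω) := fun ω => by
        rw [← Real.exp_add]; congr 1; ring
      simp_rw [h3]
      rw [← Finset.mul_expect]
      calc Real.exp (-g ^ 2) * 𝔼 ω, Real.exp ((2 * √s * g) * X ω)
          ≤ Real.exp (-g ^ 2) * Real.exp ((2 * √s * g) ^ 2) := by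
            gcongr
            exact hX _
        _ = _ := by
            rw [← Real.exp_add, mul_pow, mul_pow, Real.sq_sqrt hs0]
            congr 1; ring
  rw [← h1, integral_gaussian] at h2
  have h4 : √(Real.pi / (1 - 4 * s)) ≤ √Real.pi * Real.exp (4 * s) := by
    rw [Real.sqrt_le_left (by positivity), mul_pow, Real.sq_sqrt Real.pi_pos.le,
      div_le_iff₀ (by linarith), mul_assoc]
    -- What is left is (1 + t)²(1 − t) ≥ 1 with t = 4s ≤ 1/2.
    refine le_mul_of_one_le_right Real.pi_pos.le ?_
    have h5 := Real.add_one_le_exp (4 * s)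
    calc (1 : ℝ) ≤ (4 * s + 1) ^ 2 * (1 - 4 * s) := by nlinarith [mul_nonneg hs0 hs0]
      _ ≤ _ := by
        gcongr
        linarith
  exact le_of_mul_le_mul_left (h2.trans h4) hpi

/-! ### Decoupled exponential moments of positive semidefinite forms -/

section Forms

variable {d : ℕ}

/-- A vector with a subgaussian law has exponentially integrable quadratic forms of small trace. -/
lemma expect_exp_quadratic_le {Ω : Type*} [Fintype Ω] [Nonempty Ω]
    (z : Ω → EuclideanSpace ℝ (Fin d))
    (hz : ∀ θ, 𝔼 ω, Real.exp ⟪θ, z ω⟫ ≤ Real.exp (‖θ‖ ^ 2))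
    (u : Fin d → EuclideanSpace ℝ (Fin d)) (hu : ∀ j, ‖u j‖ = 1) (α : Fin d → ℝ)
    (hα : ∀ j, 0 ≤ α j) (hs : ∑ j, α j ≤ 1 / 8) :
    𝔼 ω, Real.exp (∑ j, α j * ⟪u j, z ω⟫ ^ 2) ≤ Real.exp (4 * ∑ j, α j) := by
  set s := ∑ j, α j with hsdef
  have hs0 : 0 ≤ s := Finset.sum_nonneg fun j _ => hα j
  rcases hs0.eq_or_lt with h0 | hpos
  · have hz0 : ∀ j, α j = 0 := fun j =>
      (Finset.sum_eq_zero_iff_of_nonneg fun j _ => hα j).1 h0.symm j (Finset.mem_univ j)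
    simp [hz0, ← h0]
  have hw : ∑ j, α j / s = 1 := by
    rw [← Finset.sum_div, ← hsdef, div_self hpos.ne']
  have h1 : ∀ ω, Real.exp (∑ j, α j * ⟪u j, z ω⟫ ^ 2)
      ≤ ∑ j, α j / s * Real.exp (s * ⟪u j, z ω⟫ ^ 2) := fun ω => by
    -- Jensen with weights αⱼ/s reduces the form to the single squares s⟨uⱼ, z⟩², so no independence
    -- between directions is needed.
    have := convexOn_exp.map_sum_le (t := Finset.univ) (w := fun j => α j / s)
      (p := fun j => s * ⟪u j, z ω⟫ ^ 2) (fun j _ => div_nonneg (hα j) hs0) hw (by simp)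
    simp only [smul_eq_mul] at this
    convert! this using 3 with j
    field_simp
  calc 𝔼 ω, Real.exp (∑ j, α j * ⟪u j, z ω⟫ ^ 2)
      ≤ 𝔼 ω, ∑ j, α j / s * Real.exp (s * ⟪u j, z ω⟫ ^ 2) :=
        Finset.expect_le_expect fun ω _ => h1 ω
    _ = ∑ j, α j / s * 𝔼 ω, Real.exp (s * ⟪u j, z ω⟫ ^ 2) := by
        rw [Finset.expect_sum_comm]
        simp_rw [Finset.mul_expect]
    _ ≤ ∑ j, α j / s * Real.exp (4 * s) := by
        refine Finset.sum_le_sum fun j _ => mul_le_mul_of_nonneg_left ?_ (div_nonneg (hα j) hs0)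
        refine expect_exp_sq_le _ (fun t => ?_) hs0 hs
        have := hz (t • u j)
        simpa [inner_smul_left, norm_smul, hu, mul_pow] using this
    _ = Real.exp (4 * s) := by rw [← Finset.sum_mul, hw, one_mul]

/-- Decoupled exponential moment of a positive semidefinite form `∑ αⱼ uⱼ uⱼᵀ` which is bounded by
`β` on a subspace `U` carrying a subgaussian law. -/
lemma expect_exp_decoupled_le {Ω : Type*} [Fintype Ω] [Nonempty Ω]
    (U : Submodule ℝ (EuclideanSpace ℝ (Fin d)))
    (z : Ω → EuclideanSpace ℝ (Fin d)) (hzU : ∀ ω, z ω ∈ U)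
    (hz : ∀ θ, 𝔼 ω, Real.exp ⟪θ, z ω⟫ ≤ Real.exp (‖θ‖ ^ 2))
    (u : Fin d → EuclideanSpace ℝ (Fin d)) (hu : ∀ j, ‖u j‖ = 1) (α : Fin d → ℝ)
    (hα : ∀ j, 0 ≤ α j) {β : ℝ} (hβ : 0 ≤ β)
    (hq : ∀ x ∈ U, ∑ j, α j * ⟪u j, x⟫ ^ 2 ≤ β * ‖x‖ ^ 2) (l : ℝ)
    (hs : l ^ 2 * β * ∑ j, α j ≤ 1 / 8) :
    𝔼 ω', 𝔼 ω, Real.exp (l * ∑ j, α j * (⟪u j, z ω⟫ * ⟪u j, z ω'⟫))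
      ≤ Real.exp (4 * (l ^ 2 * β * ∑ j, α j)) := by
  have key : ∀ ω', 𝔼 ω, Real.exp (l * ∑ j, α j * (⟪u j, z ω⟫ * ⟪u j, z ω'⟫))
      ≤ Real.exp (∑ j, (l ^ 2 * β * α j) * ⟪u j, z ω'⟫ ^ 2) := by
    intro ω'
    -- Here a = Az', and since z lies in `U` only its projection b matters.
    set a := ∑ j, (α j * ⟪u j, z ω'⟫) • u j with ha
    set b := U.starProjection a with hb
    have hbU : b ∈ U := U.starProjection_apply_mem a
    have hinner : ∀ x ∈ U, ⟪b, x⟫ = ∑ j, α j * (⟪u j, x⟫ * ⟪u j, z ω'⟫) := by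
      intro x hx
      rw [hb, U.inner_starProjection_left_eq_right, U.starProjection_eq_self_iff.2 hx, ha,
        sum_inner]
      refine Finset.sum_congr rfl fun j _ => ?_
      rw [real_inner_smul_left]; ring
    -- Write q for the form. Cauchy–Schwarz for q gives ‖b‖⁴ ≤ q(b) q(z') ≤ β‖b‖² q(z'). The
    -- remaining average over z' thus involves only a form of trace l²β∑αⱼ.
    have hbb : ‖b‖ ^ 2 ≤ β * ∑ j, α j * ⟪u j, z ω'⟫ ^ 2 := by
      have h1 : ‖b‖ ^ 2 = ∑ j, (√(α j) * ⟪u j, b⟫) * (√(α j) * ⟪u j, z ω'⟫) := by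
        rw [← real_inner_self_eq_norm_sq, hinner b hbU]
        refine Finset.sum_congr rfl fun j _ => ?_
        nth_rewrite 1 [← Real.mul_self_sqrt (hα j)]
        ring
      have h2 := Finset.sum_mul_sq_le_sq_mul_sq Finset.univ
        (fun j => √(α j) * ⟪u j, b⟫) (fun j => √(α j) * ⟪u j, z ω'⟫)
      rw [← h1] at h2
      simp_rw [mul_pow, Real.sq_sqrt (hα _)] at h2
      have h3 := hq b hbU
      have h4 : 0 ≤ ∑ j, α j * ⟪u j, z ω'⟫ ^ 2 :=
        Finset.sum_nonneg fun j _ => mul_nonneg (hα j) (sq_nonneg _)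
      rcases (sq_nonneg ‖b‖).eq_or_lt with h0 | hpos
      · rw [← h0]; positivity
      · have h5 := h2.trans (mul_le_mul_of_nonneg_right h3 h4)
        refine le_of_mul_le_mul_left ?_ hpos
        linarith
    calc 𝔼 ω, Real.exp (l * ∑ j, α j * (⟪u j, z ω⟫ * ⟪u j, z ω'⟫))
        = 𝔼 ω, Real.exp ⟪l • b, z ω⟫ := by
          refine Finset.expect_congr rfl fun ω _ => ?_
          rw [real_inner_smul_left, hinner _ (hzU ω)]
      _ ≤ Real.exp (‖l • b‖ ^ 2) := hz _
      _ ≤ _ := by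
          rw [norm_smul, mul_pow, Real.norm_eq_abs, sq_abs, Real.exp_le_exp]
          calc l ^ 2 * ‖b‖ ^ 2 ≤ l ^ 2 * (β * ∑ j, α j * ⟪u j, z ω'⟫ ^ 2) := by gcongr
            _ = _ := by
              rw [← mul_assoc, Finset.mul_sum]
              exact Finset.sum_congr rfl fun j _ => by ring
  calc _ ≤ 𝔼 ω', Real.exp (∑ j, (l ^ 2 * β * α j) * ⟪u j, z ω'⟫ ^ 2) :=
        Finset.expect_le_expect fun ω' _ => key ω'
    _ ≤ _ := by
        rw [Finset.mul_sum] at hs ⊢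
        exact expect_exp_quadratic_le z hz u hu _
          (fun j => mul_nonneg (mul_nonneg (sq_nonneg l) hβ) (hα j)) hs

/-- The bilinear form of a positive semidefinite matrix in an orthonormal eigenbasis. -/
lemma dotProduct_mulVec_eq_sum_eigenvalues {A : Matrix (Fin d) (Fin d) ℝ} (hA : A.IsHermitian)
    (x y : EuclideanSpace ℝ (Fin d)) :
    x.ofLp ⬝ᵥ A *ᵥ y.ofLp = ∑ j, hA.eigenvalues j *
      (⟪hA.eigenvectorBasis j, x⟫ * ⟪hA.eigenvectorBasis j, y⟫) := by
  have hAt : Aᵀ = A := by simpa using hA.eq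
  have h1 : ∀ j, ⟪hA.eigenvectorBasis j, WithLp.toLp 2 (A *ᵥ y.ofLp)⟫
      = hA.eigenvalues j * ⟪hA.eigenvectorBasis j, y⟫ := fun j => by
    rw [EuclideanSpace.inner_eq_star_dotProduct, EuclideanSpace.inner_eq_star_dotProduct]
    simp only [star_trivial]
    rw [dotProduct_comm, Matrix.dotProduct_mulVec, ← Matrix.mulVec_transpose, hAt,
      hA.mulVec_eigenvectorBasis, smul_dotProduct, smul_eq_mul, dotProduct_comm]
  have h2 : x.ofLp ⬝ᵥ A *ᵥ y.ofLp = ⟪x, WithLp.toLp 2 (A *ᵥ y.ofLp)⟫ := by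
    rw [EuclideanSpace.inner_eq_star_dotProduct, dotProduct_comm]
    simp
  rw [h2, ← hA.eigenvectorBasis.sum_inner_mul_inner]
  refine Finset.sum_congr rfl fun j _ => ?_
  rw [h1, real_inner_comm]
  ring

/-- A positive semidefinite matrix is at most twice its normalized trace on a subspace of at least
half the dimension. -/
lemma exists_subspace_form_le (hd : 0 < d) {B : Matrix (Fin d) (Fin d) ℝ} (hB : B.PosSemidef) :
    ∃ G : Submodule ℝ (EuclideanSpace ℝ (Fin d)), 2 * Module.finrank ℝ G ≤ d ∧
      ∀ x ∈ Gᗮ, x.ofLp ⬝ᵥ B *ᵥ x.ofLp ≤ 2 * B.trace / d * ‖x‖ ^ 2 := by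
  classical
  have hd' : (0 : ℝ) < d := by exact_mod_cast hd
  set b := hB.1.eigenvectorBasis with hb
  set μ := hB.1.eigenvalues with hμ
  have hμ0 : ∀ j, 0 ≤ μ j := hB.eigenvalues_nonneg
  have htr : B.trace = ∑ j, μ j := by simpa using hB.1.trace_eq_sum_eigenvalues
  -- More than d/2 eigenvalues above twice their mean would exceed the trace, so it suffices to
  -- discard these eigenvectors.
  set F := Finset.univ.filter fun j => 2 * B.trace / d < μ j with hF
  refine ⟨Submodule.span ℝ (F.image b : Set (EuclideanSpace ℝ (Fin d))), ?_, fun x hx => ?_⟩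
  · have h1 : Module.finrank ℝ (Submodule.span ℝ (F.image b : Set (EuclideanSpace ℝ (Fin d))))
        ≤ F.card := (finrank_span_finset_le_card _).trans Finset.card_image_le
    suffices h : 2 * F.card ≤ d by omega
    by_contra! hlt
    have hlt' : (d : ℝ) < 2 * F.card := by exact_mod_cast hlt
    have hne : F.Nonempty := Finset.card_pos.1 (by omega)
    have ht0 : 0 ≤ B.trace := htr ▸ Finset.sum_nonneg fun j _ => hμ0 j
    have h2 : F.card * (2 * B.trace / d) < B.trace := by
      calc F.card * (2 * B.trace / d) = ∑ j ∈ F, 2 * B.trace / d := by simp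
        _ < ∑ j ∈ F, μ j := Finset.sum_lt_sum_of_nonempty hne fun j hj =>
            (Finset.mem_filter.1 hj).2
        _ ≤ B.trace := htr ▸
            Finset.sum_le_sum_of_subset_of_nonneg (Finset.subset_univ _) fun j _ _ => hμ0 j
    rw [mul_div_assoc', div_lt_iff₀ hd'] at h2
    nlinarith
  · rw [dotProduct_mulVec_eq_sum_eigenvalues hB.1, ← b.sum_sq_norm_inner_right x, Finset.mul_sum]
    refine Finset.sum_le_sum fun j _ => ?_
    rw [← hb, ← hμ, Real.norm_eq_abs, sq_abs, ← pow_two]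
    by_cases hj : j ∈ F
    · have h0 : ⟪b j, x⟫ = 0 :=
        Submodule.inner_right_of_mem_orthogonal (Submodule.subset_span
          (Finset.mem_coe.2 (Finset.mem_image_of_mem _ hj))) hx
      simp [h0]
    · have : μ j ≤ 2 * B.trace / d := by simpa [hF] using hj
      gcongr

lemma posSemidef_multiset_sum (T : Multiset (Matrix (Fin d) (Fin d) ℝ))
    (hT : ∀ A ∈ T, A.PosSemidef) : T.sum.PosSemidef :=
  Multiset.sum_induction _ T (fun _ _ => Matrix.PosSemidef.add) Matrix.PosSemidef.zero hT

lemma norm_sq_le_sum_abs (z : EuclideanSpace ℝ (Fin d)) (hz : ∀ i, |z i| ≤ 1) :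
    ‖z‖ ^ 2 ≤ ∑ i, |z i| := by
  rw [EuclideanSpace.real_norm_sq_eq]
  refine Finset.sum_le_sum fun i _ => ?_
  rw [← sq_abs]
  nlinarith [abs_nonneg (z i), hz i]

/-- A distribution on the cube `[-1, 1]^d` whose `ℓ¹` norm is of order `d` with constant
probability, and for which every matrix in a given multiset of positive semidefinite matrices has a
small decoupled exponential moment. -/
lemma exists_common_distribution (hd : 0 < d) (T : Multiset (Matrix (Fin d) (Fin d) ℝ))
    (τ R : ℝ) (hT : ∀ A ∈ T, A.PosSemidef) (hτ : ∀ A ∈ T, A.trace ≤ τ) (hτ0 : 0 ≤ τ)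
    (hR : (T.card : ℝ) ≤ R) :
    ∃ (Ω : Type) (_ : Fintype Ω) (_ : Nonempty Ω) (z : Ω → Fin d → ℝ),
      (∀ ω i, |z ω i| ≤ 1) ∧
      (1 / 10 : ℝ) ≤ 𝔼 ω, (if (d / 8 : ℝ) ≤ ∑ i, |z ω i| then 1 else 0) ∧
      ∀ A ∈ T, ∀ l : ℝ, l ^ 2 * (2 * R * τ / d) * τ ≤ 1 / 8 →
        𝔼 ω', 𝔼 ω, Real.exp (l * (z ω ⬝ᵥ A *ᵥ z ω'))
          ≤ Real.exp (4 * (l ^ 2 * (2 * R * τ / d) * τ)) := by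
  have hd' : (0 : ℝ) < d := by exact_mod_cast hd
  have hR0 : 0 ≤ R := (Nat.cast_nonneg _).trans hR
  have hB := posSemidef_multiset_sum T hT
  obtain ⟨G, hG, hGq⟩ := exists_subspace_form_le hd hB
  have htr : T.sum.trace ≤ R * τ := by
    have h1 : T.sum.trace = (T.map Matrix.trace).sum :=
      map_multiset_sum (Matrix.traceAddMonoidHom (Fin d) ℝ) T
    rw [h1]
    calc (T.map Matrix.trace).sum ≤ (T.map Matrix.trace).card • τ :=
          Multiset.sum_le_card_nsmul _ _ (by simpa using hτ)
      _ ≤ R * τ := by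
        rw [Multiset.card_map, nsmul_eq_mul]
        gcongr
  obtain ⟨Ω, i1, i2, z, hz1, hzG, hsub, hsq⟩ := exists_subgaussian_in_subspace hd G hG
  refine ⟨Ω, i1, i2, fun ω => (z ω).ofLp, hz1, ?_, fun A hA l hl => ?_⟩
  -- As ‖z‖² ≤ ∑|zᵢ| ≤ d, averaging gives d/4 ≤ d/8 + (7d/8)·P, so the event has probability P ≥
  -- 1/7.
  · have h1 : ∀ ω, ‖z ω‖ ^ 2
        ≤ d / 8 + 7 / 8 * d * (if (d / 8 : ℝ) ≤ ∑ i, |z ω i| then 1 else 0) := fun ω => by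
      have h2 := norm_sq_le_sum_abs (z ω) (hz1 ω)
      have h3 : ∑ i, |z ω i| ≤ d := by
        simpa using Finset.sum_le_sum fun i (_ : i ∈ Finset.univ) => hz1 ω i
      split_ifs with h <;> linarith
    have h4 := hsq.trans (Finset.expect_le_expect fun ω _ => h1 ω)
    rw [Finset.expect_add_distrib, Fintype.expect_const, ← Finset.mul_expect] at h4
    have h5 : (1 / 8 : ℝ) * d
        ≤ (7 / 8 * 𝔼 ω, (if (d / 8 : ℝ) ≤ ∑ i, |z ω i| then 1 else 0)) * d := by linarith
    have := le_of_mul_le_mul_right h5 hd'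
    linarith
  · have hAh := (hT A hA).1
    have hα0 := (hT A hA).eigenvalues_nonneg
    have hsum : ∑ j, hAh.eigenvalues j ≤ τ := by
      have := hAh.trace_eq_sum_eigenvalues
      simp only [RCLike.ofReal_real_eq_id, id] at this
      rw [← this]
      exact hτ A hA
    have hq : ∀ x ∈ Gᗮ, ∑ j, hAh.eigenvalues j * ⟪hAh.eigenvectorBasis j, x⟫ ^ 2
        ≤ 2 * R * τ / d * ‖x‖ ^ 2 := fun x hx => by
      -- The other summands have nonnegative forms, so A inherits the bound of the whole sum.
      obtain ⟨T', rfl⟩ := Multiset.exists_cons_of_mem hA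
      have h1 := (posSemidef_multiset_sum T' fun A' hA' =>
        hT A' (Multiset.mem_cons_of_mem hA')).dotProduct_mulVec_nonneg x.ofLp
      have h2 := hGq x hx
      rw [Multiset.sum_cons, Matrix.add_mulVec, dotProduct_add] at h2
      rw [star_trivial] at h1
      calc ∑ j, hAh.eigenvalues j * ⟪hAh.eigenvectorBasis j, x⟫ ^ 2
          = x.ofLp ⬝ᵥ A *ᵥ x.ofLp := by
            rw [dotProduct_mulVec_eq_sum_eigenvalues hAh]
            simp_rw [pow_two]
        _ ≤ 2 * (A + T'.sum).trace / d * ‖x‖ ^ 2 := by linarith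
        _ ≤ _ := by
          rw [Multiset.sum_cons] at htr
          rw [mul_assoc 2 R τ]
          gcongr
    have hβ : 0 ≤ 2 * R * τ / d := by positivity
    have h3 : l ^ 2 * (2 * R * τ / d) * ∑ j, hAh.eigenvalues j
        ≤ l ^ 2 * (2 * R * τ / d) * τ := by gcongr
    have h4 := expect_exp_decoupled_le Gᗮ z hzG hsub hAh.eigenvectorBasis
      (fun j => hAh.eigenvectorBasis.orthonormal.1 j) hAh.eigenvalues hα0 hβ hq l (h3.trans hl)
    simp_rw [dotProduct_mulVec_eq_sum_eigenvalues hAh]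
    exact h4.trans (Real.exp_le_exp.2 (by linarith))

end Forms

/-! ### Trace and nuclear norm -/

lemma singularValues_toEuclideanLin_eq_norm {d : ℕ} (A : Matrix (Fin d) (Fin d) ℝ) :
    ∃ v : OrthonormalBasis (Fin d) ℝ (EuclideanSpace ℝ (Fin d)),
      ∀ i : Fin d, (Matrix.toEuclideanLin A).singularValues i = ‖Matrix.toEuclideanLin A (v i)‖ := by
  set T := Matrix.toEuclideanLin A
  have hd : Module.finrank ℝ (EuclideanSpace ℝ (Fin d)) = d := by simp
  refine ⟨T.isSymmetric_adjoint_comp_self.eigenvectorBasis hd, fun i => ?_⟩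
  rw [T.singularValues_fin hd, Real.sqrt_eq_iff_eq_sq
    (T.isPositive_adjoint_comp_self.nonneg_eigenvalues hd i) (norm_nonneg _),
    ← real_inner_self_eq_norm_sq, ← LinearMap.adjoint_inner_right]
  have h := T.isSymmetric_adjoint_comp_self.apply_eigenvectorBasis hd i
  rw [LinearMap.comp_apply] at h
  rw [h, inner_smul_right, real_inner_self_eq_norm_sq]
  simp

/-- Compute the trace in the basis of right singular vectors: ⟨vᵢ, Avᵢ⟩ ≤ ‖Avᵢ‖ = σᵢ. -/
lemma trace_le_nuclearNorm {d : ℕ} (A : Matrix (Fin d) (Fin d) ℝ) :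
    A.trace ≤ nuclearNorm A := by
  obtain ⟨v, hv⟩ := singularValues_toEuclideanLin_eq_norm A
  have h1 : A.trace = LinearMap.trace ℝ _ (Matrix.toEuclideanLin A) := by
    rw [LinearMap.trace_eq_sum_inner _ (EuclideanSpace.basisFun (Fin d) ℝ)]
    refine Finset.sum_congr rfl fun i _ => ?_
    simp [EuclideanSpace.inner_single_left, Matrix.toLpLin_apply]
  rw [h1, LinearMap.trace_eq_sum_inner _ v, nuclearNorm]
  refine Finset.sum_le_sum fun i _ => ?_
  rw [hv]
  refine (real_inner_le_norm _ _).trans ?_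
  simp

/-- A crude bound, needed only for finiteness: the real `sSup` in `maxNuclear` is an upper bound
only for a set bounded above. -/
lemma nuclearNorm_le_of_entries {d : ℕ} (A : Matrix (Fin d) (Fin d) ℝ)
    (hA : ∀ i j, |A i j| ≤ 2) : nuclearNorm A ≤ d * √(d * (d * 2) ^ 2) := by
  obtain ⟨v, hv⟩ := singularValues_toEuclideanLin_eq_norm A
  calc nuclearNorm A ≤ ∑ _i : Fin d, √(d * (d * 2) ^ 2) := Finset.sum_le_sum fun l _ => ?_
    _ = _ := by simp
  rw [hv]
  refine Real.le_sqrt_of_sq_le ?_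
  rw [EuclideanSpace.real_norm_sq_eq]
  calc _ ≤ ∑ _i : Fin d, ((d : ℝ) * 2) ^ 2 := Finset.sum_le_sum fun i _ => ?_
    _ = _ := by simp
  refine sq_le_sq' ?_ ?_ <;>
  · have h1 : |∑ j, A i j * v l j| ≤ d * 2 := by
      calc |∑ j, A i j * v l j| ≤ ∑ j, |A i j * v l j| := Finset.abs_sum_le_sum_abs _ _
        _ ≤ ∑ _j : Fin d, (2 : ℝ) := Finset.sum_le_sum fun j _ => by
            rw [abs_mul]
            have h2 : |v l j| ≤ 1 := by
              simpa using (PiLp.norm_apply_le (v l) j)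
            nlinarith [hA i j, abs_nonneg (A i j), abs_nonneg (v l j)]
        _ = _ := by simp
    have := abs_le.1 h1
    simp only [Matrix.toLpLin_apply, Matrix.mulVec, dotProduct]
    linarith [this.1, this.2]

/-! ### The matrix H(W) and the convexity of its trace -/

variable {k : ℕ} {Y : Type*}

/-- The difference of the output probabilities of the `i`-th pair of inputs. -/
def pairDiff (W : Fin k → Y → ℝ) (i : Fin (k / 2)) (y : Y) : ℝ :=
  W (oddSym i) y - W (evenSym i) y

lemma IsChannel.abs_pairDiff_le {W : Fin k → Y → ℝ} (hW : IsChannel W) (i : Fin (k / 2)) (y : Y) :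
    |pairDiff W i y| ≤ ∑ x, W x y := by
  have h1 := Finset.single_le_sum (fun x _ => hW.1 x y) (Finset.mem_univ (oddSym i))
  have h2 := Finset.single_le_sum (fun x _ => hW.1 x y) (Finset.mem_univ (evenSym i))
  have h3 := hW.1 (oddSym i) y
  have h4 := hW.1 (evenSym i) y
  rw [pairDiff, abs_le]
  constructor <;> linarith

lemma IsChannel.abs_term_le {W : Fin k → Y → ℝ} (hW : IsChannel W) (i j : Fin (k / 2)) (y : Y) :
    |pairDiff W i y * pairDiff W j y / ∑ x, W x y| ≤ W (oddSym i) y + W (evenSym i) y := by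
  have h0 : 0 ≤ ∑ x, W x y := Finset.sum_nonneg fun x _ => hW.1 x y
  have h3 := hW.1 (oddSym i) y
  have h4 := hW.1 (evenSym i) y
  have h5 : |pairDiff W i y| ≤ W (oddSym i) y + W (evenSym i) y := by
    rw [pairDiff, abs_le]
    constructor <;> linarith
  rw [abs_div, abs_mul, abs_of_nonneg h0, mul_div_assoc]
  have h6 : |pairDiff W j y| / ∑ x, W x y ≤ 1 := div_le_one_of_le₀ (hW.abs_pairDiff_le j y) h0
  have h7 : 0 ≤ |pairDiff W j y| / ∑ x, W x y := by positivity
  nlinarith [abs_nonneg (pairDiff W i y)]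

lemma IsChannel.hasSum_H {W : Fin k → Y → ℝ} (hW : IsChannel W) (i j : Fin (k / 2)) :
    HasSum (fun y => pairDiff W i y * pairDiff W j y / ∑ x, W x y) (H W i j) := by
  refine Summable.hasSum ?_
  refine Summable.of_norm_bounded ((hW.2 (oddSym i)).add (hW.2 (evenSym i))).summable fun y => ?_
  exact hW.abs_term_le i j y

lemma IsChannel.abs_H_le {W : Fin k → Y → ℝ} (hW : IsChannel W) (i j : Fin (k / 2)) :
    |H W i j| ≤ 2 := by
  have h1 := (hW.2 (oddSym i)).add (hW.2 (evenSym i))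
  have h2 := tsum_of_norm_bounded
    (f := fun y => pairDiff W i y * pairDiff W j y / ∑ x, W x y) h1 fun y => hW.abs_term_le i j y
  rw [(hW.hasSum_H i j).tsum_eq, Real.norm_eq_abs] at h2
  linarith

lemma IsChannel.hasSum_dotProduct_H {W : Fin k → Y → ℝ} (hW : IsChannel W)
    (a b : Fin (k / 2) → ℝ) :
    HasSum (fun y => (∑ i, a i * pairDiff W i y) * (∑ j, b j * pairDiff W j y) / ∑ x, W x y)
      (a ⬝ᵥ H W *ᵥ b) := by
  have h := hasSum_sum fun i (_ : i ∈ Finset.univ) =>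
    (hasSum_sum fun j (_ : j ∈ Finset.univ) => (hW.hasSum_H i j).mul_right (b j)).mul_left (a i)
  refine (congrArg (HasSum · _) (funext fun y => ?_)).mpr h
  rw [Finset.sum_mul_sum, Finset.sum_div]
  refine Finset.sum_congr rfl fun i _ => ?_
  rw [Finset.sum_div, Finset.mul_sum]
  exact Finset.sum_congr rfl fun j _ => by ring

lemma IsChannel.posSemidef_H {W : Fin k → Y → ℝ} (hW : IsChannel W) : (H W).PosSemidef := by
  rw [Matrix.posSemidef_iff_dotProduct_mulVec]
  refine ⟨?_, fun a => ?_⟩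
  · ext i j
    simp only [Matrix.conjTranspose_apply, star_trivial, H]
    exact tsum_congr fun y => by ring
  · refine (hW.hasSum_dotProduct_H (star a) a).nonneg fun y => ?_
    rw [star_trivial]
    exact div_nonneg (mul_self_nonneg _) (Finset.sum_nonneg fun x _ => hW.1 x y)

lemma IsChannel.hasSum_trace_H {W : Fin k → Y → ℝ} (hW : IsChannel W) :
    HasSum (fun y => ∑ i, pairDiff W i y ^ 2 / ∑ x, W x y) (H W).trace := by
  have h := hasSum_sum fun i (_ : i ∈ Finset.univ) => hW.hasSum_H i i
  simp only [← pow_two] at h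
  exact h

/-- Joint convexity of `(x, u) ↦ x² / u` on `|x| ≤ u`, with the convention `0 / 0 = 0`. -/
lemma sq_div_convex {a b x y u v : ℝ} (ha : 0 ≤ a) (hb : 0 ≤ b)
    (hx : |x| ≤ u) (hy : |y| ≤ v) :
    (a * x + b * y) ^ 2 / (a * u + b * v) ≤ a * (x ^ 2 / u) + b * (y ^ 2 / v) := by
  have hu : 0 ≤ u := (abs_nonneg x).trans hx
  have hv : 0 ≤ v := (abs_nonneg y).trans hy
  have hx2 : x ^ 2 = x ^ 2 / u * u := by
    rcases hu.eq_or_lt with h | h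
    · have : x = 0 := by rw [← h] at hx; exact abs_nonpos_iff.1 hx
      simp [this]
    · field_simp
  have hy2 : y ^ 2 = y ^ 2 / v * v := by
    rcases hv.eq_or_lt with h | h
    · have : y = 0 := by rw [← h] at hy; exact abs_nonpos_iff.1 hy
      simp [this]
    · field_simp
  have hp : 0 ≤ x ^ 2 / u := by positivity
  have hq : 0 ≤ y ^ 2 / v := by positivity
  generalize x ^ 2 / u = p at *
  generalize y ^ 2 / v = q at *
  refine div_le_of_le_mul₀ (by positivity) (by positivity) ?_
  -- AM–GM, since x²y² = (pu)(qv) = (pv)(qu).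
  have hxy : 2 * (x * y) ≤ p * v + q * u := by
    have h1 : (x * y) ^ 2 ≤ ((p * v + q * u) / 2) ^ 2 := by
      rw [mul_pow, hx2, hy2]
      nlinarith [sq_nonneg (p * v - q * u)]
    have := abs_le_of_sq_le_sq h1 (by positivity)
    linarith [le_abs_self (x * y)]
  calc (a * x + b * y) ^ 2 = a ^ 2 * x ^ 2 + b ^ 2 * y ^ 2 + a * b * (2 * (x * y)) := by ring
    _ ≤ a ^ 2 * (p * u) + b ^ 2 * (q * v) + a * b * (p * v + q * u) := by
      rw [← hx2, ← hy2]
      gcongr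
    _ = _ := by ring

lemma IsChannel.combo {V W : Fin k → Y → ℝ} (hV : IsChannel V) (hW : IsChannel W) {a b : ℝ}
    (ha : 0 ≤ a) (hb : 0 ≤ b) (hab : a + b = 1) : IsChannel (a • V + b • W) := by
  refine ⟨fun x y => ?_, fun x => ?_⟩
  · have h1 := hV.1 x y
    have h2 := hW.1 x y
    simp only [Pi.add_apply, Pi.smul_apply, smul_eq_mul]
    positivity
  · have := ((hV.2 x).mul_left a).add ((hW.2 x).mul_left b)
    rwa [mul_one, mul_one, hab] at this

/-- The trace is a sum of terms x²/u with x and u linear in W, each jointly convex. This is why the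
trace, rather than the nuclear norm, is carried to the hull. -/
lemma convex_channels_trace_le (M : ℝ) :
    Convex ℝ {W : Fin k → Y → ℝ | IsChannel W ∧ (H W).trace ≤ M} := by
  rintro V ⟨hV, hVM⟩ W ⟨hW, hWM⟩ a b ha hb hab
  have hc := hV.combo hW ha hb hab
  refine ⟨hc, ?_⟩
  have h1 := (hV.hasSum_trace_H.mul_left a).add (hW.hasSum_trace_H.mul_left b)
  calc (H (a • V + b • W)).trace ≤ a * (H V).trace + b * (H W).trace := by
        refine hasSum_le (fun y => ?_) hc.hasSum_trace_H h1
        rw [Finset.mul_sum, Finset.mul_sum, ← Finset.sum_add_distrib]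
        refine Finset.sum_le_sum fun i _ => ?_
        have h2 := sq_div_convex ha hb (hV.abs_pairDiff_le i y) (hW.abs_pairDiff_le i y)
        have h3 : pairDiff (a • V + b • W) i y = a * pairDiff V i y + b * pairDiff W i y := by
          simp only [pairDiff, Pi.add_apply, Pi.smul_apply, smul_eq_mul]
          ring
        have h4 : ∑ x, (a • V + b • W) x y = a * ∑ x, V x y + b * ∑ x, W x y := by
          simp only [Pi.add_apply, Pi.smul_apply, smul_eq_mul, Finset.sum_add_distrib,
            Finset.mul_sum]
        rw [h3, h4]
        exact h2
    _ ≤ a * M + b * M := by gcongr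
    _ = M := by rw [← add_mul, hab, one_mul]

lemma bddAbove_nuclearNorm {𝒲 : Set (Fin k → Y → ℝ)} (h𝒲 : ∀ W ∈ 𝒲, IsChannel W) :
    BddAbove ((fun W => nuclearNorm (H W)) '' 𝒲) := by
  refine ⟨((k / 2 : ℕ) : ℝ) * √((k / 2 : ℕ) * ((k / 2 : ℕ) * 2) ^ 2), ?_⟩
  rintro _ ⟨W, hW, rfl⟩
  exact nuclearNorm_le_of_entries _ (h𝒲 W hW).abs_H_le

lemma convexHull_subset_channels {𝒲 : Set (Fin k → Y → ℝ)} (h𝒲 : ∀ W ∈ 𝒲, IsChannel W) :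
    convexHull ℝ 𝒲 ⊆ {W | IsChannel W ∧ (H W).trace ≤ maxNuclear 𝒲} :=
  convexHull_min (fun W hW => ⟨h𝒲 W hW, (trace_le_nuclearNorm _).trans
    (le_csSup (bddAbove_nuclearNorm h𝒲) ⟨W, hW, rfl⟩)⟩) (convex_channels_trace_le _)

lemma maxNuclear_nonneg (𝒲 : Set (Fin k → Y → ℝ)) : 0 ≤ maxNuclear 𝒲 := by
  refine Real.sSup_nonneg ?_
  rintro _ ⟨W, _, rfl⟩
  exact Finset.sum_nonneg fun i _ => LinearMap.singularValues_nonneg _ _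

/-! ### Pairwise perturbations of the uniform distribution -/

/-- The decomposition of an even number of symbols into pairs. -/
def pairEquiv (hk : Even k) : Fin (k / 2) ⊕ Fin (k / 2) ≃ Fin k :=
  Equiv.ofBijective (Sum.elim oddSym evenSym) <| by
    constructor
    · rintro (i | i) (j | j) h <;> simp only [Sum.elim_inl, Sum.elim_inr, oddSym, evenSym,
        Fin.mk.injEq] at h
      · congr 1; ext; omega
      · omega
      · omega
      · congr 1; ext; omega
    · intro x
      obtain ⟨m, hm⟩ := hk
      have hx : x.1 / 2 < k / 2 := by omega
      rcases Nat.even_or_odd x.1 with h | h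
      · refine ⟨Sum.inl ⟨x.1 / 2, hx⟩, Fin.ext ?_⟩
        simp only [Sum.elim_inl, oddSym]
        rcases h with ⟨r, hr⟩
        omega
      · refine ⟨Sum.inr ⟨x.1 / 2, hx⟩, Fin.ext ?_⟩
        simp only [Sum.elim_inr, evenSym]
        rcases h with ⟨r, hr⟩
        omega

lemma sum_pairs (hk : Even k) (f : Fin k → ℝ) :
    ∑ x, f x = ∑ i, (f (oddSym i) + f (evenSym i)) := by
  rw [← (pairEquiv hk).sum_comp, Fintype.sum_sum_type, Finset.sum_add_distrib]
  rfl

/-- The vector on `[k]` which is `z i` and `-z i` on the `i`-th pair of symbols. -/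
def signedPairs (hk : Even k) (z : Fin (k / 2) → ℝ) (x : Fin k) : ℝ :=
  Sum.elim z (-z) ((pairEquiv hk).symm x)

lemma signedPairs_oddSym (hk : Even k) (z : Fin (k / 2) → ℝ) (i : Fin (k / 2)) :
    signedPairs hk z (oddSym i) = z i := by
  have : oddSym i = pairEquiv hk (Sum.inl i) := rfl
  rw [signedPairs, this, Equiv.symm_apply_apply, Sum.elim_inl]

lemma signedPairs_evenSym (hk : Even k) (z : Fin (k / 2) → ℝ) (i : Fin (k / 2)) :
    signedPairs hk z (evenSym i) = -z i := by
  have : evenSym i = pairEquiv hk (Sum.inr i) := rfl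
  rw [signedPairs, this, Equiv.symm_apply_apply, Sum.elim_inr, Pi.neg_apply]

lemma abs_signedPairs_le (hk : Even k) {z : Fin (k / 2) → ℝ} (hz : ∀ i, |z i| ≤ 1) (x : Fin k) :
    |signedPairs hk z x| ≤ 1 := by
  rw [signedPairs]
  rcases (pairEquiv hk).symm x with i | i <;> simp [hz i]

/-- The perturbation of the uniform distribution along the pairs of symbols. -/
def perturbed (hk : Even k) (c : ℝ) (z : Fin (k / 2) → ℝ) (x : Fin k) : ℝ :=
  1 / (k : ℝ) + c / k * signedPairs hk z x

lemma perturbed_mem_stdSimplex (hk : Even k) (hk0 : 0 < k) {c : ℝ} (hc0 : 0 ≤ c) (hc : c ≤ 1)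
    {z : Fin (k / 2) → ℝ} (hz : ∀ i, |z i| ≤ 1) : perturbed hk c z ∈ stdSimplex ℝ (Fin k) := by
  have hk' : (0 : ℝ) < k := by exact_mod_cast hk0
  refine ⟨fun x => ?_, ?_⟩
  · have h1 := (abs_le.1 (abs_signedPairs_le hk hz x)).1
    have h2 : perturbed hk c z x = (1 + c * signedPairs hk z x) / k := by
      rw [perturbed]; ring
    rw [h2]
    refine div_nonneg ?_ hk'.le
    nlinarith
  · simp_rw [perturbed]
    rw [Finset.sum_add_distrib, ← Finset.mul_sum, sum_pairs hk (signedPairs hk z)]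
    simp only [signedPairs_oddSym, signedPairs_evenSym, add_neg_cancel, Finset.sum_const_zero,
      mul_zero, add_zero]
    simp [hk'.ne']

lemma tvDist_perturbed (hk : Even k) {c : ℝ} (hc0 : 0 ≤ c)
    (z : Fin (k / 2) → ℝ) : tvDist (perturbed hk c z) (unif k) = c / k * ∑ i, |z i| := by
  rw [tvDist, sum_pairs hk, Finset.mul_sum, Finset.mul_sum]
  refine Finset.sum_congr rfl fun i _ => ?_
  have : 0 ≤ c / k := by positivity
  simp only [perturbed, unif, signedPairs_oddSym, signedPairs_evenSym, add_sub_cancel_left,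
    abs_mul, abs_neg, abs_of_nonneg this]
  ring

lemma induced_unif (W : Fin k → Y → ℝ) (y : Y) :
    induced W (unif k) y = (∑ x, W x y) / k := by
  simp only [induced, unif, Finset.sum_div, mul_one_div]

lemma induced_perturbed_sub (hk : Even k) (W : Fin k → Y → ℝ) (c : ℝ) (z : Fin (k / 2) → ℝ)
    (y : Y) : induced W (perturbed hk c z) y - induced W (unif k) y
      = c / k * ∑ i, z i * pairDiff W i y := by
  rw [induced, induced, ← Finset.sum_sub_distrib, sum_pairs hk, Finset.mul_sum]
  refine Finset.sum_congr rfl fun i _ => ?_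
  simp only [perturbed, unif, signedPairs_oddSym, signedPairs_evenSym, pairDiff]
  ring

lemma deltaInner_perturbed (hk : Even k) (hk0 : 0 < k) {W : Fin k → Y → ℝ} (hW : IsChannel W)
    (c : ℝ) (z z' : Fin (k / 2) → ℝ) :
    deltaInner (unif k) W (perturbed hk c z) (perturbed hk c z')
      = c ^ 2 / k * (z ⬝ᵥ H W *ᵥ z') := by
  have hk' : (k : ℝ) ≠ 0 := by exact_mod_cast hk0.ne'
  rw [← (hW.hasSum_dotProduct_H z z').tsum_eq, deltaInner, ← tsum_mul_left]
  refine tsum_congr fun y => ?_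
  simp only [delta, induced_perturbed_sub]
  simp only [induced_unif]
  -- Outputs of total weight zero contribute 0 to both sides by the convention for division by zero.
  by_cases h : ∑ x, W x y = 0
  · simp [h]
  · field_simp

lemma integral_uniform {Ω : Type} [Fintype Ω] [Nonempty Ω] [MeasurableSpace Ω]
    [MeasurableSingletonClass Ω] (f : Ω → ℝ) :
    ∫ ω, f ω ∂(PMF.uniformOfFintype Ω).toMeasure = 𝔼 ω, f ω := by
  rw [PMF.integral_eq_sum, Fintype.expect_eq_sum_div_card, Finset.sum_div]
  refine Finset.sum_congr rfl fun ω _ => ?_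
  simp [div_eq_inv_mul]

/-- The almost perturbation defined by a finitely supported uniform law on the cube. -/
def uniformPerturbation (hk : Even k) (hk0 : 0 < k) {ε : ℝ} (hε0 : 0 ≤ ε) (hε : 16 * ε ≤ 1)
    {Ω : Type} [Fintype Ω] [Nonempty Ω] (z : Ω → Fin (k / 2) → ℝ) (hz : ∀ ω i, |z ω i| ≤ 1)
    (hfar : (1 / 10 : ℝ) ≤
      𝔼 ω, (if (((k / 2 : ℕ) : ℝ) / 8 : ℝ) ≤ ∑ i, |z ω i| then 1 else 0)) :
    AlmostPerturbation (unif k) ε :=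
  letI : MeasurableSpace Ω := ⊤
  { Z := Ω
    p := fun ω => perturbed hk (16 * ε) (z ω)
    measurable_p := measurable_from_top
    p_mem := fun ω => perturbed_mem_stdSimplex hk hk0 (by linarith) hε (hz ω)
    ζ := (PMF.uniformOfFintype Ω).toMeasure
    far := by
      refine hfar.trans ?_
      rw [← integral_uniform, ← integral_indicator_one (MeasurableSpace.measurableSet_top)]
      refine integral_mono .of_finite .of_finite fun ω => ?_
      simp only [Set.indicator_apply, Set.mem_ofPred_eq, Pi.one_apply]
      split_ifs with h1 h2 h2
      · exact le_rfl
      · refine absurd ?_ h2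
        have hk' : (0 : ℝ) < k := by exact_mod_cast hk0
        have h3 : ((k / 2 : ℕ) : ℝ) = k / 2 := by
          rw [Nat.cast_div_charZero hk.two_dvd, Nat.cast_ofNat]
        rw [h3] at h1
        rw [tvDist_perturbed hk (by linarith)]
        -- The factor 16 is chosen so that ∑|zᵢ| ≥ d/8 = k/16 means distance at least ε.
        calc ε = 16 * ε / k * (k / 2 / 8) := by field_simp; ring
          _ ≤ _ := by gcongr
      · exact zero_le_one
      · exact le_rfl }

lemma chiSq_uniformPerturbation {n : ℕ} (hk : Even k) (hk0 : 0 < k) {ε : ℝ} (hε0 : 0 ≤ ε)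
    (hε : 16 * ε ≤ 1) {Ω : Type} [Fintype Ω] [Nonempty Ω] (z : Ω → Fin (k / 2) → ℝ)
    (hz : ∀ ω i, |z ω i| ≤ 1) (hfar : (1 / 10 : ℝ) ≤
      𝔼 ω, (if (((k / 2 : ℕ) : ℝ) / 8 : ℝ) ≤ ∑ i, |z ω i| then 1 else 0))
    (Wn : Fin n → Fin k → Y → ℝ) (hW : ∀ i, IsChannel (Wn i)) :
    chiSq Wn (uniformPerturbation hk hk0 hε0 hε z hz hfar)
      = Real.log (𝔼 ω', 𝔼 ω,
          Real.exp ((16 * ε) ^ 2 / k * (z ω ⬝ᵥ (∑ i, H (Wn i)) *ᵥ z ω'))) := by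
  let _ : MeasurableSpace Ω := ⊤
  have h1 : ∀ ω ω', ∑ i, deltaInner (unif k) (Wn i) (perturbed hk (16 * ε) (z ω))
      (perturbed hk (16 * ε) (z ω'))
      = (16 * ε) ^ 2 / k * (z ω ⬝ᵥ (∑ i, H (Wn i)) *ᵥ z ω') := fun ω ω' => by
    simp_rw [deltaInner_perturbed hk hk0 (hW _)]
    rw [← Finset.mul_sum, Matrix.sum_mulVec, dotProduct_sum]
  rw [chiSq]
  congr 1
  change ∫ p : Ω × Ω, Real.exp (∑ i, deltaInner (unif k) (Wn i) (perturbed hk (16 * ε) (z p.1))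
      (perturbed hk (16 * ε) (z p.2))) ∂((PMF.uniformOfFintype Ω).toMeasure.prod
        (PMF.uniformOfFintype Ω).toMeasure) = _
  rw [integral_prod _ .of_finite]
  simp_rw [integral_uniform, h1]
  exact Finset.expect_comm _ _ _

/-- A single almost perturbation has small decoupled chi-square fluctuation simultaneously for all
tuples in a given multiset of tuples of channels. -/
lemma exists_perturbation_chiSq_le {k n : ℕ} {Y : Type*} (hk : Even k) (hk0 : 0 < k) {ε : ℝ}
    (hε0 : 0 ≤ ε) (hε : 16 * ε ≤ 1) (S : Multiset (Fin n → Fin k → Y → ℝ)) {M R : ℝ} (hM : 0 ≤ M)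
    (hS : ∀ Wn ∈ S, ∀ i, IsChannel (Wn i) ∧ (H (Wn i)).trace ≤ M) (hR : (S.card : ℝ) ≤ R)
    (hn : 2 ^ 21 * ((n : ℝ) ^ 2 * ε ^ 4 / k ^ 3 * R * M ^ 2) ≤ 1) :
    ∃ P : AlmostPerturbation (unif k) ε, ∀ Wn ∈ S,
      chiSq Wn P ≤ 2 ^ 20 * ((n : ℝ) ^ 2 * ε ^ 4 / k ^ 3 * R * M ^ 2) := by
  have hk' : (0 : ℝ) < k := by exact_mod_cast hk0
  have hd : 0 < k / 2 := by
    obtain ⟨m, hm⟩ := hk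
    omega
  have hd2 : ((k / 2 : ℕ) : ℝ) = k / 2 := by
    rw [Nat.cast_div_charZero hk.two_dvd, Nat.cast_ofNat]
  have hpsd : ∀ A ∈ S.map fun Wn => ∑ i, H (Wn i), A.PosSemidef := by
    intro A hA
    obtain ⟨Wn, hWn, rfl⟩ := Multiset.mem_map.1 hA
    exact Matrix.posSemidef_sum _ fun i _ => (hS Wn hWn i).1.posSemidef_H
  have htr : ∀ A ∈ S.map fun Wn => ∑ i, H (Wn i), A.trace ≤ n * M := by
    intro A hA
    obtain ⟨Wn, hWn, rfl⟩ := Multiset.mem_map.1 hA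
    rw [Matrix.trace_sum]
    calc ∑ i, (H (Wn i)).trace ≤ ∑ _i : Fin n, M :=
          Finset.sum_le_sum fun i _ => (hS Wn hWn i).2
      _ = n * M := by simp
  obtain ⟨Ω, _, _, z, hz, hfar, hexp⟩ := exists_common_distribution hd
    (S.map fun Wn => ∑ i, H (Wn i)) (n * M) R hpsd htr (by positivity) (by simpa using hR)
  refine ⟨uniformPerturbation hk hk0 hε0 hε z hz hfar, fun Wn hWn => ?_⟩
  rw [chiSq_uniformPerturbation hk hk0 hε0 hε z hz hfar Wn fun i => (hS Wn hWn i).1]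
  -- This is l²βτ, with 2^18 = 16⁴ · 4; the requirement l²βτ ≤ 1/8 becomes the factor 2^21, and the
  -- exponent 4l²βτ the factor 2^20.
  have hX : ((16 * ε) ^ 2 / k : ℝ) ^ 2 * (2 * R * (n * M) / (k / 2 : ℕ)) * (n * M)
      = 2 ^ 18 * ((n : ℝ) ^ 2 * ε ^ 4 / k ^ 3 * R * M ^ 2) := by
    rw [hd2]
    field_simp
    ring
  have h := hexp _ (Multiset.mem_map_of_mem _ hWn) ((16 * ε) ^ 2 / k)
    (by rw [hX]; linarith)
  rw [hX] at h
  have hpos : 0 < 𝔼 ω', 𝔼 ω,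
      Real.exp ((16 * ε) ^ 2 / k * (z ω ⬝ᵥ (∑ i, H (Wn i)) *ᵥ z ω')) :=
    Finset.expect_pos (fun ω' _ => Finset.expect_pos (fun ω _ => Real.exp_pos _)
      Finset.univ_nonempty) Finset.univ_nonempty
  refine ((Real.log_le_iff_le_exp hpos).2 h).trans (le_of_eq ?_)
  ring

end Semimaxmin
end

/-! ### The theorem: choice of constants -/

theorem mainTheorem7 :
    ∃ C > (0 : ℝ), ∃ K > (0 : ℝ),
      ∀ (k n s : ℕ) (ε : ℝ) (Y : Type*) (𝒲 : Set (Fin k → Y → ℝ)),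
        Even k → 2 ≤ k → 0 < ε → ε < 1 / (12 * √2) →
        𝒲.Nonempty → (∀ W ∈ 𝒲, Semimaxmin.IsChannel W) →
        C * ε ^ 2 * (2 : ℝ) ^ ((s : ℝ) / 2) * Semimaxmin.maxNuclear 𝒲 * (n : ℝ) ≤
          (k : ℝ) ^ ((3 : ℝ) / 2) →
        Semimaxmin.semimaxmin (Semimaxmin.unif k) 𝒲 n ε s ≤
          ((K * ((n : ℝ) ^ 2 * ε ^ 4 / (k : ℝ) ^ 3 * 2 ^ s * Semimaxmin.maxNuclear 𝒲 ^ 2) : ℝ) :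
            EReal) := by
  -- Squaring the condition on n gives a factor 2^22, which covers the 2^21 needed.
  refine ⟨2 ^ 11, by norm_num, 2 ^ 20, by norm_num, ?_⟩
  intro k n s ε Y 𝒲 hk hk2 hε0 hε _ h𝒲 hn
  have hk0 : 0 < k := by omega
  have hk' : (0 : ℝ) < k := by exact_mod_cast hk0
  have hM := Semimaxmin.maxNuclear_nonneg 𝒲
  have hε16 : 16 * ε ≤ 1 := by
    -- Hence 12√2 ≥ 16, which keeps the perturbed masses nonnegative.
    have h1 : (4 / 3 : ℝ) ≤ √2 := Real.le_sqrt_of_sq_le (by norm_num)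
    have h2 : 0 < 12 * √2 := by positivity
    rw [lt_div_iff₀ h2] at hε
    nlinarith
  have hsmall : 2 ^ 21 *
      ((n : ℝ) ^ 2 * ε ^ 4 / k ^ 3 * 2 ^ s * Semimaxmin.maxNuclear 𝒲 ^ 2) ≤ 1 := by
    have h1 := pow_le_pow_left₀ (by positivity) hn 2
    have h2 : ((2 : ℝ) ^ ((s : ℝ) / 2)) ^ 2 = 2 ^ s := by
      rw [← Real.rpow_mul_natCast (by norm_num)]
      simp
    have h3 : ((k : ℝ) ^ ((3 : ℝ) / 2)) ^ 2 = k ^ 3 := by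
      rw [← Real.rpow_mul_natCast hk'.le, ← Real.rpow_natCast]
      norm_num
    simp only [mul_pow, h2] at h1
    rw [h3] at h1
    have h4 : 2 ^ 21 * ((n : ℝ) ^ 2 * ε ^ 4 / k ^ 3 * 2 ^ s * Semimaxmin.maxNuclear 𝒲 ^ 2)
        = 2 ^ 21 * ((n : ℝ) ^ 2 * ε ^ 4 * 2 ^ s * Semimaxmin.maxNuclear 𝒲 ^ 2) / k ^ 3 := by
      ring
    rw [h4, div_le_one (by positivity)]
    have h5 : 0 ≤ (n : ℝ) ^ 2 * ε ^ 4 * 2 ^ s * Semimaxmin.maxNuclear 𝒲 ^ 2 := by positivity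
    linarith
  refine iSup_le fun S => iSup_le fun hS0 => iSup_le fun hScard => iSup_le fun hS => ?_
  obtain ⟨P, hP⟩ := Semimaxmin.exists_perturbation_chiSq_le (R := 2 ^ s) hk hk0 hε0.le hε16 S hM
    (fun Wn hWn i => Semimaxmin.convexHull_subset_channels h𝒲 (hS Wn hWn i))
    (by exact_mod_cast hScard) hsmall
  -- One perturbation bounds every tuple of `S`, so the average is at most the common bound;
  -- truncation at 1 is not needed.
  refine (iInf_le _ P).trans (EReal.coe_le_coe_iff.2 ?_)
  have hc : (0 : ℝ) < S.card := by exact_mod_cast Multiset.card_pos.2 hS0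
  rw [div_le_iff₀ hc, mul_comm, ← nsmul_eq_mul,
    ← Multiset.card_map (fun Wn => min (Semimaxmin.chiSq Wn P) 1) S]
  refine Multiset.sum_le_card_nsmul _ _ fun x hx => ?_
  obtain ⟨Wn, hWn, rfl⟩ := Multiset.mem_map.1 hx
  exact (min_le_left _ _).trans (hP Wn hWn)
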